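/- Let $d\lambda(z)=\frac1\pi e^{-|z|^2}\,dA(z)$ be the Gaussian measure on $\mathbb C$, where $dA$ is area measure, and let the Fock space $F^2$ be the space of all entire functions $f$ with $\|f\|^2=\int_{\mathbb C}|f(z)|^2\,d\lambda(z)<\infty$, with the inner product of $L^2(\mathbb C,d\lambda)$. Let $B$ be the Bargmann transform, $$B\varphi(z)=\left(\frac2\pi\right)^{1/4}\int_{\mathbb R}\varphi(x)\,e^{2xz-x^2-z^2/2}\,dx,\qquad \varphi\in L^2(\mathbb R),\ z\in\mathbb C,$$ and let $T$ be the unbounded operator $T\varphi(x)=x\varphi(x)$ on $L^2(\mathbb R)$, with its natural domain $\{\varphi\in L^2(\mathbb R): x\varphi\in L^2(\mathbb R)\}$. Then $B$ is a unitary operator from $L^2(\mathbb R)$ onto $F^2$, the domain of $BTB^{-1}$ consists exactly of those $f\in F^2$ for which the entire function $\frac12\left[zf(z)+f'(z)\right]$ belongs to $F^2$, and for every such $f$ $$BTB^{-1}f(z)=\frac12\left[zf(z)+f'(z)\right],\qquad z\in\mathbb C.$$ -/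

import Mathlib

open MeasureTheory
open scoped ComplexConjugate

noncomputable section

namespace Bargmann

/-- The Hilbert space `L²(ℝ) = L²(ℝ, dx)` of complex-valued functions. -/
abbrev L2R : Type := Lp ℂ 2 (volume : Measure ℝ)

/-- The Gaussian measure `dλ(z) = π⁻¹ exp (-|z|²) dA(z)` on the complex plane. -/
def gaussian : Measure ℂ :=
  volume.withDensity fun z : ℂ => ENNReal.ofReal (Real.pi⁻¹ * Real.exp (-‖z‖ ^ 2))

theorem volume_absolutelyContinuous_gaussian : (volume : Measure ℂ) ≪ gaussian := by
  refine withDensity_absolutelyContinuous' ?_ (Filter.Eventually.of_forall fun z => ?_)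
  · exact (by fun_prop : Measurable fun z : ℂ =>
      ENNReal.ofReal (Real.pi⁻¹ * Real.exp (-‖z‖ ^ 2))).aemeasurable
  · have : 0 < Real.pi⁻¹ * Real.exp (-‖z‖ ^ 2) := by positivity
    simpa using this

/-- The entire functions that are square integrable for the Gaussian measure. -/
def fockSubmodule : Submodule ℂ (ℂ → ℂ) where
  carrier := {f | Differentiable ℂ f ∧ MemLp f 2 gaussian}
  add_mem' hf hg := ⟨hf.1.add hg.1, hf.2.add hg.2⟩
  zero_mem' := ⟨differentiable_const 0, MemLp.zero⟩
  smul_mem' a _ hf := ⟨hf.1.const_smul a, hf.2.const_smul a⟩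

/-- The Fock space `F²`. (A type of its own, so that it carries the topology of its norm and not
the topology of pointwise convergence.) -/
def FockSpace : Type := fockSubmodule

namespace FockSpace

instance : AddCommGroup FockSpace := inferInstanceAs (AddCommGroup fockSubmodule)

instance : Module ℂ FockSpace := inferInstanceAs (Module ℂ fockSubmodule)

/-- Elements of the Fock space are functions on the complex plane. -/
instance : FunLike FockSpace ℂ ℂ where
  coe f := Subtype.val (p := fun g => g ∈ fockSubmodule) f
  coe_injective _ _ h := Subtype.ext h

/-- A function in `fockSubmodule`, as an element of the Fock space. -/
def mk (f : ℂ → ℂ) (hf : f ∈ fockSubmodule) : FockSpace := ⟨f, hf⟩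

@[simp] theorem mk_apply (f : ℂ → ℂ) (hf : f ∈ fockSubmodule) (z : ℂ) : mk f hf z = f z := rfl

@[ext] theorem ext {f g : FockSpace} (h : ∀ z, f z = g z) : f = g := DFunLike.ext f g h

theorem differentiable (f : FockSpace) : Differentiable ℂ f := (show fockSubmodule from f).2.1

theorem memLp (f : FockSpace) : MemLp f 2 gaussian :=
  (show fockSubmodule from f).2.2

@[simp] theorem add_apply (f g : FockSpace) (z : ℂ) : (f + g) z = f z + g z := rfl

@[simp] theorem zero_apply (z : ℂ) : (0 : FockSpace) z = 0 := rfl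

@[simp] theorem smul_apply (a : ℂ) (f : FockSpace) (z : ℂ) : (a • f) z = a * f z := rfl

theorem integrable_conj_mul (f g : FockSpace) :
    Integrable (fun z => conj (f z) * g z) gaussian :=
  f.memLp.star.integrable_mul g.memLp

theorem integral_conj_mul_self (f : FockSpace) :
    ∫ z, conj (f z) * f z ∂gaussian = ((∫ z, ‖f z‖ ^ 2 ∂gaussian : ℝ) : ℂ) := by
  rw [← integral_complex_ofReal]
  refine integral_congr_ae (Filter.Eventually.of_forall fun z => ?_)
  simp [RCLike.conj_mul]

/-- The inner product `⟨f, g⟩ = ∫ conj (f z) * g z dλ(z)` of `L²(ℂ, dλ)`, restricted to `F²`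
(conjugate-linear in the first variable, as everywhere in Mathlib). -/
instance core : InnerProductSpace.Core ℂ FockSpace where
  inner f g := ∫ z, conj (f z) * g z ∂gaussian
  conj_inner_symm f g := by
    rw [← integral_conj]
    refine integral_congr_ae (Filter.Eventually.of_forall fun z => ?_)
    simp [mul_comm]
  re_inner_nonneg f := by
    rw [integral_conj_mul_self]
    refine le_of_le_of_eq ?_ (Complex.ofReal_re _).symm
    exact integral_nonneg fun z => by positivity
  add_left f g h := by
    rw [← integral_add (integrable_conj_mul f h) (integrable_conj_mul g h)]
    refine integral_congr_ae (Filter.Eventually.of_forall fun z => ?_)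
    simp [add_mul]
  smul_left f g a := by
    rw [← integral_const_mul]
    refine integral_congr_ae (Filter.Eventually.of_forall fun z => ?_)
    simp [mul_assoc]
  definite f hf := by
    have h0 : ∫ z, ‖f z‖ ^ 2 ∂gaussian = 0 := by
      have := (integral_conj_mul_self f).symm.trans hf
      exact_mod_cast this
    rw [integral_eq_zero_iff_of_nonneg (fun z => by positivity)
      (f.memLp.integrable_norm_pow (by norm_num))] at h0
    have h1 : f =ᵐ[volume] fun _ => (0 : ℂ) := by
      filter_upwards [volume_absolutelyContinuous_gaussian.ae_le h0] with z hz
      simpa using hz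
    have h2 := (Continuous.ae_eq_iff_eq volume f.differentiable.continuous continuous_const).1 h1
    exact FockSpace.ext fun z => congrFun h2 z

instance : NormedAddCommGroup FockSpace := core.toNormedAddCommGroup

instance : InnerProductSpace ℂ FockSpace := InnerProductSpace.ofCore core.toCore

theorem inner_def (f g : FockSpace) : inner ℂ f g = ∫ z, conj (f z) * g z ∂gaussian := rfl

/-- The norm of the Fock space is the one it should be. -/
theorem norm_sq_eq (f : FockSpace) : ‖f‖ ^ 2 = ∫ z, ‖f z‖ ^ 2 ∂gaussian := by
  have h' := inner_self_eq_norm_sq_to_K (𝕜 := ℂ) f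
  rw [inner_def, integral_conj_mul_self] at h'
  exact (Complex.ofReal_injective (h'.trans (Complex.ofReal_pow _ _).symm)).symm

end FockSpace

/-- The Bargmann transform
`B φ (z) = c ∫ φ(x) exp (2 x z - x² - z² / 2) dx`, where `c = (2 / π) ^ (1 / 4)`. -/
def bargmann (φ : L2R) (z : ℂ) : ℂ :=
  (((2 / Real.pi) ^ (1 / 4 : ℝ) : ℝ) : ℂ) *
    ∫ x : ℝ, φ x * Complex.exp (2 * (x : ℂ) * z - (x : ℂ) ^ 2 - z ^ 2 / 2)

/-- The integral that defines the Bargmann transform converges absolutely. -/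
theorem integrable_bargmann (φ : L2R) (z : ℂ) :
    Integrable fun x : ℝ => φ x * Complex.exp (2 * (x : ℂ) * z - (x : ℂ) ^ 2 - z ^ 2 / 2) := by
  have hk : MemLp (fun x : ℝ => Complex.exp (2 * (x : ℂ) * z - (x : ℂ) ^ 2 - z ^ 2 / 2)) 2
      volume := by
    rw [memLp_two_iff_integrable_sq_norm (by fun_prop)]
    have h := (integrable_cexp_quadratic' (b := -2) (by norm_num) (4 * z) (-z ^ 2)).norm
    refine h.congr (Filter.Eventually.of_forall fun x => ?_)
    beta_reduce
    rw [← norm_pow, ← Complex.exp_nat_mul]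
    congr 2
    push_cast
    ring
  exact (Lp.memLp φ).integrable_mul hk

/-- The (unbounded) operator of multiplication by `x` on `L²(ℝ)`, on its natural domain, the set of
all `φ` in `L²(ℝ)` for which `x φ(x)` is again in `L²(ℝ)`. -/
def mulX : L2R →ₗ.[ℂ] L2R where
  domain :=
    { carrier := {φ | MemLp (fun x : ℝ => (x : ℂ) * φ x) 2 volume}
      add_mem' := fun {φ ψ} hφ hψ => by
        refine (memLp_congr_ae ?_).1 (MemLp.add hφ hψ)
        filter_upwards [Lp.coeFn_add φ ψ] with x hx
        rw [hx]
        exact (mul_add _ _ _).symm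
      zero_mem' := by
        refine (memLp_congr_ae ?_).1 (MemLp.zero (ε := ℂ) (p := 2) (μ := (volume : Measure ℝ)))
        filter_upwards [Lp.coeFn_zero ℂ 2 (volume : Measure ℝ)] with x hx
        rw [hx]
        exact (mul_zero _).symm
      smul_mem' := fun a φ hφ => by
        refine (memLp_congr_ae ?_).1 (MemLp.const_smul hφ a)
        filter_upwards [Lp.coeFn_smul a φ] with x hx
        rw [hx]
        exact mul_left_comm _ _ _ }
  toFun :=
    { toFun := fun φ => MemLp.toLp (fun x : ℝ => (x : ℂ) * (φ : L2R) x) φ.2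
      map_add' := fun φ ψ => by
        rw [← MemLp.toLp_add]
        refine MemLp.toLp_congr _ _ ?_
        filter_upwards [Lp.coeFn_add (φ : L2R) ψ] with x hx
        refine (congrArg ((x : ℂ) * ·) hx).trans ?_
        exact mul_add _ _ _
      map_smul' := fun a φ => by
        rw [RingHom.id_apply, ← MemLp.toLp_const_smul]
        refine MemLp.toLp_congr _ _ ?_
        filter_upwards [Lp.coeFn_smul a (φ : L2R)] with x hx
        refine (congrArg ((x : ℂ) * ·) hx).trans ?_
        exact mul_left_comm _ _ _ }

/-- The (unbounded) operator `f ↦ (z f(z) + f'(z)) / 2` on `F²`, on its natural domain, the set of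
all `f` in `F²` for which `(z f(z) + f'(z)) / 2` is again in `F²`. -/
def fockX : FockSpace →ₗ.[ℂ] FockSpace where
  domain :=
    { carrier := {f | (fun z : ℂ => 1 / 2 * (z * f z + deriv f z)) ∈ fockSubmodule}
      add_mem' := fun {f g} hf hg => by
        have h : (fun z : ℂ => 1 / 2 * (z * (f + g) z + deriv (f + g) z)) =
            (fun z : ℂ => 1 / 2 * (z * f z + deriv f z)) +
              fun z : ℂ => 1 / 2 * (z * g z + deriv g z) := by
          funext z
          have : deriv (f + g) z = deriv f z + deriv g z :=
            deriv_add (f.differentiable z) (g.differentiable z)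
          simp only [FockSpace.add_apply, this, Pi.add_apply]
          ring
        show _ ∈ fockSubmodule
        rw [h]
        exact fockSubmodule.add_mem hf hg
      zero_mem' := by
        have h : (fun z : ℂ => 1 / 2 * (z * (0 : FockSpace) z + deriv (0 : FockSpace) z)) = 0 := by
          funext z
          have : deriv (0 : FockSpace) z = 0 := deriv_const z (0 : ℂ)
          simp [this]
        show _ ∈ fockSubmodule
        rw [h]
        exact fockSubmodule.zero_mem
      smul_mem' := fun a f hf => by
        have h : (fun z : ℂ => 1 / 2 * (z * (a • f) z + deriv (a • f) z)) =
            a • fun z : ℂ => 1 / 2 * (z * f z + deriv f z) := by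
          funext z
          have : deriv (a • f) z = a * deriv f z := deriv_const_mul a (f.differentiable z)
          simp only [FockSpace.smul_apply, this, Pi.smul_apply, smul_eq_mul]
          ring
        show _ ∈ fockSubmodule
        rw [h]
        exact fockSubmodule.smul_mem a hf }
  toFun :=
    { toFun := fun f =>
        FockSpace.mk (fun z : ℂ => 1 / 2 * (z * (f : FockSpace) z + deriv (f : FockSpace) z)) f.2
      map_add' := fun f g => FockSpace.ext fun z => by
        have : deriv ((f : FockSpace) + (g : FockSpace)) z =
            deriv (f : FockSpace) z + deriv (g : FockSpace) z :=
          deriv_add ((f : FockSpace).differentiable z) ((g : FockSpace).differentiable z)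
        simp only [Submodule.coe_add, FockSpace.add_apply, FockSpace.mk_apply, this]
        ring
      map_smul' := fun a f => FockSpace.ext fun z => by
        have : deriv (a • (f : FockSpace)) z = a * deriv (f : FockSpace) z :=
          deriv_const_mul a ((f : FockSpace).differentiable z)
        simp only [Submodule.coe_smul, FockSpace.smul_apply, FockSpace.mk_apply, this, RingHom.id_apply]
        ring }

/-- The conjugate `U T U⁻¹` of an unbounded operator `T` by a unitary operator `U`. Its domain is
the set of all `f` for which `U⁻¹ f` is in the domain of `T`. -/
def conjOp {E F : Type*} [NormedAddCommGroup E] [InnerProductSpace ℂ E] [NormedAddCommGroup F]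
    [InnerProductSpace ℂ F] (U : E ≃ₗᵢ[ℂ] F) (T : E →ₗ.[ℂ] E) : F →ₗ.[ℂ] F where
  domain := T.domain.comap U.symm.toLinearEquiv.toLinearMap
  toFun :=
    { toFun := fun f => U (T ⟨U.symm f, f.2⟩)
      map_add' := fun f g => by
        rw [← map_add, ← T.map_add]
        congr 2
        exact Subtype.ext (map_add U.symm (f : F) g)
      map_smul' := fun a f => by
        rw [RingHom.id_apply, ← map_smul, ← T.map_smul]
        congr 2
        exact Subtype.ext (map_smul U.symm a (f : F)) }

end Bargmann

end

/-! Isometry: put z = u + iv. Up to elementary factors, `bargmann φ z` is the Fourier transform of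
φ(x) exp(-(x-u)²) at -v/π, and those factors exactly cancel the weight exp(-|z|²). Plancherel in v
and a Gaussian integral in u then give `lintegral_enorm_bargmann_sq`.

Surjectivity: the range is complete and contains every z ↦ exp(zw). Pairing f ∈ F² with such an
exponential returns f(conj w) (`integral_conj_exp_mul`, from the mean value property), so only 0 is
orthogonal to the range.

Operator: differentiating under the integral turns (zf + f')/2 into the integral of xφ against the
kernel, for every φ in L². If xφ is in L², this is its transform. If instead (zf + f')/2 lies in F²,
it is the transform of some ψ, and Fourier uniqueness forces ψ = xφ (`ae_eq_mul_of_bargmann_eq`). -/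

noncomputable section

namespace Bargmann

open FourierTransform Real

/-! ### Plancherel and uniqueness for the Fourier integral -/

/-- For integrable functions in `L²`, the `L²`-Fourier transform is given by the Fourier integral. -/
theorem coeFn_fourier_toLp {g : ℝ → ℂ} (hg : Integrable g) (hg2 : MemLp g 2) :
    (𝓕 (hg2.toLp g) : L2R) =ᵐ[volume] 𝓕 g := by
  have hcont : Continuous (𝓕 g) :=
    VectorFourier.fourierIntegral_continuous Real.continuous_fourierChar
      (by fun_prop) hg
  -- Both sides are compared as distributions: tested against a bump function, the transform passes
  -- to the test function.
  refine ae_eq_of_integral_contDiff_smul_eq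
    ((Lp.memLp _).locallyIntegrable (by norm_num)) hcont.locallyIntegrable fun s hs hsupp => ?_
  have hs' : ContDiff ℝ (⊤ : ℕ∞) fun x => (s x : ℂ) := Complex.ofRealCLM.contDiff.comp hs
  have hsupp' : HasCompactSupport fun x => (s x : ℂ) := hsupp.comp_left Complex.ofReal_zero
  let S : SchwartzMap ℝ ℂ := hsupp'.toSchwartzMap hs'
  have h1 := congrArg (fun T : TemperedDistribution ℝ ℂ => T S)
    (Lp.fourier_toTemperedDistribution_eq (hg2.toLp g))
  simp only [TemperedDistribution.fourier_apply, Lp.toTemperedDistribution_apply] at h1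
  have h2 : ∫ x, (𝓕 S) x • (hg2.toLp g) x = ∫ x, (𝓕 S) x • g x := by
    refine integral_congr_ae ?_
    filter_upwards [hg2.coeFn_toLp] with x hx
    rw [hx]
  have h3 : ∫ x, (𝓕 S) x • g x = ∫ x, S x • 𝓕 g x := by
    rw [SchwartzMap.fourier_coe]
    simpa using! VectorFourier.integral_fourierIntegral_smul_eq_flip (L := innerₗ ℝ)
      Real.continuous_fourierChar (by fun_prop) S.integrable hg
  have h4 := h1.symm.trans (h2.trans h3)
  exact h4

/-- Plancherel's theorem for integrable functions in `L²`. -/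
theorem eLpNorm_fourier {g : ℝ → ℂ} (hg : Integrable g) (hg2 : MemLp g 2) :
    eLpNorm (𝓕 g) 2 volume = eLpNorm g 2 volume := by
  rw [← eLpNorm_congr_ae (coeFn_fourier_toLp hg hg2), ← eLpNorm_congr_ae hg2.coeFn_toLp,
    ← Lp.enorm_def, ← Lp.enorm_def, ← ofReal_norm, ← ofReal_norm, Lp.norm_fourier_eq]

theorem lintegral_enorm_fourier_sq {g : ℝ → ℂ} (hg : Integrable g) (hg2 : MemLp g 2) :
    ∫⁻ ξ, ‖𝓕 g ξ‖ₑ ^ 2 = ∫⁻ x, ‖g x‖ₑ ^ 2 := by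
  have h := congrArg (· ^ 2) (eLpNorm_fourier hg hg2)
  simpa [← eLpNorm_nnreal_pow_eq_lintegral (p := 2) two_ne_zero] using
    (eLpNorm_nnreal_pow_eq_lintegral (p := 2) (μ := volume) (f := 𝓕 g) two_ne_zero).symm.trans
      ((by simpa using h : _ = _).trans
        (eLpNorm_nnreal_pow_eq_lintegral (p := 2) (μ := volume) (f := g) two_ne_zero))

theorem ae_eq_zero_of_fourier_eq_zero {g : ℝ → ℂ} (hg : Integrable g) (hg2 : MemLp g 2)
    (h : ∀ ξ, 𝓕 g ξ = 0) : g =ᵐ[volume] 0 := by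
  rw [← eLpNorm_eq_zero_iff hg2.1 two_ne_zero, ← eLpNorm_fourier hg hg2, (funext h : 𝓕 g = 0),
    eLpNorm_zero]

/-! ### Gaussian integrals over the plane -/

/-- The Gaussian mean value property of entire functions. -/
theorem integral_mul_exp_neg_norm_sq {g : ℂ → ℂ} (hg : Differentiable ℂ g)
    (hint : Integrable fun z : ℂ => g z * ((rexp (-‖z‖ ^ 2) : ℝ) : ℂ)) :
    ∫ z : ℂ, g z * ((rexp (-‖z‖ ^ 2) : ℝ) : ℂ) = π * g 0 := by
  have hgc := hg.continuous
  rw [← Complex.integral_comp_polarCoord_symm]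
  have hint' : IntegrableOn (fun p : ℝ × ℝ => p.1 • (g (Complex.polarCoord.symm p) *
      ((rexp (-‖Complex.polarCoord.symm p‖ ^ 2) : ℝ) : ℂ))) polarCoord.target := by
    refine ⟨Continuous.aestronglyMeasurable (by simp; fun_prop), ?_⟩
    have h := hint.2
    rw [hasFiniteIntegral_iff_enorm, ← Complex.lintegral_comp_polarCoord_symm] at h
    rw [hasFiniteIntegral_iff_enorm]
    refine lt_of_le_of_lt (le_of_eq ?_) h
    refine setLIntegral_congr_fun polarCoord.open_target.measurableSet fun p hp => ?_
    have hp' : 0 < p.1 := hp.1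
    rw [enorm_smul, Real.enorm_of_nonneg hp'.le, smul_eq_mul]
  have htarget : polarCoord.target = Set.Ioi (0 : ℝ) ×ˢ Set.Ioo (-π) π := rfl
  rw [htarget] at hint' ⊢
  rw [Measure.volume_eq_prod] at hint' ⊢
  rw [setIntegral_prod _ hint']
  have hr : ∀ r ∈ Set.Ioi (0 : ℝ), (∫ θ in Set.Ioo (-π) π, r • (g (Complex.polarCoord.symm (r, θ)) *
      ((rexp (-‖Complex.polarCoord.symm (r, θ)‖ ^ 2) : ℝ) : ℂ))) =
      (r * Complex.exp (-1 * (r : ℂ) ^ 2)) * (2 * π * g 0) := by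
    intro r hr
    have hmean : Real.circleAverage g 0 r = g 0 :=
      DiffContOnCl.circleAverage hg.diffContOnCl
    rw [Real.circleAverage_def] at hmean
    have hper : Function.Periodic (fun θ => g (circleMap 0 r θ)) (2 * π) := fun θ => by
      simp only [periodic_circleMap 0 r θ]
    -- Polar coordinates use angles in (-π, π), the circle average uses (0, 2π).
    have hshift := hper.intervalIntegral_add_eq (-π) 0
    have hpi : (π : ℂ) ≠ 0 := by exact_mod_cast Real.pi_ne_zero
    rw [show -π + 2 * π = π by ring, zero_add] at hshift
    rw [← hshift, intervalIntegral.integral_of_le (by linarith [Real.pi_pos]),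
      integral_Ioc_eq_integral_Ioo] at hmean
    have : ∀ θ, r • (g (Complex.polarCoord.symm (r, θ)) *
        ((rexp (-‖Complex.polarCoord.symm (r, θ)‖ ^ 2) : ℝ) : ℂ)) =
        (r * Complex.exp (-1 * (r : ℂ) ^ 2)) * g (circleMap 0 r θ) := by
      intro θ
      have hz : Complex.polarCoord.symm (r, θ) = circleMap 0 r θ := by
        rw [Complex.polarCoord_symm_apply, circleMap, Complex.exp_mul_I]
        push_cast
        ring
      rw [Complex.norm_polarCoord_symm, hz, sq_abs, Complex.real_smul]
      push_cast
      rw [neg_one_mul]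
      ring
    simp_rw [this]
    rw [integral_const_mul, ← hmean, Complex.real_smul]
    push_cast
    field_simp
  rw [setIntegral_congr_fun measurableSet_Ioi hr, integral_mul_const,
    integral_mul_cexp_neg_mul_sq (by simp)]
  ring

theorem lintegral_gaussian {f : ℂ → ENNReal} (hf : Measurable f) :
    ∫⁻ z, f z ∂gaussian = ∫⁻ z, ENNReal.ofReal (π⁻¹ * rexp (-‖z‖ ^ 2)) * f z :=
  lintegral_withDensity_eq_lintegral_mul _ (by fun_prop) hf

theorem integral_gaussian_measure (f : ℂ → ℂ) :
    ∫ z, f z ∂gaussian = ∫ z, ((π⁻¹ * rexp (-‖z‖ ^ 2) : ℝ) : ℂ) * f z := by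
  rw [gaussian, integral_withDensity_eq_integral_toReal_smul (by fun_prop) (by simp)]
  refine integral_congr_ae (.of_forall fun z => ?_)
  simp only [Complex.real_smul]
  rw [ENNReal.toReal_ofReal (by positivity)]

theorem integrable_gaussian_iff (f : ℂ → ℂ) :
    Integrable f gaussian ↔ Integrable fun z : ℂ => ((π⁻¹ * rexp (-‖z‖ ^ 2) : ℝ) : ℂ) * f z := by
  rw [gaussian, integrable_withDensity_iff_integrable_smul' (by fun_prop) (by simp)]
  refine integrable_congr (.of_forall fun z => ?_)
  simp only [Complex.real_smul]
  rw [ENNReal.toReal_ofReal (by positivity)]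

/-! ### Holomorphy and derivative of the transform -/

theorem memLp_exp_quadratic (w : ℂ) :
    MemLp (fun x : ℝ => Complex.exp (2 * (x : ℂ) * w - (x : ℂ) ^ 2)) 2 volume := by
  rw [memLp_two_iff_integrable_sq_norm (by fun_prop)]
  refine (integrable_cexp_quadratic' (b := -2) (by norm_num) (4 * w) 0).norm.congr
    (.of_forall fun x => ?_)
  beta_reduce
  rw [← norm_pow, ← Complex.exp_nat_mul]
  congr 2
  push_cast
  ring

theorem integrable_mul_exp (φ : L2R) (z : ℂ) :
    Integrable fun x : ℝ => φ x * Complex.exp (2 * (x : ℂ) * z - (x : ℂ) ^ 2) :=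
  (Lp.memLp φ).integrable_mul (memLp_exp_quadratic z)

theorem bargmann_eq (φ : L2R) (z : ℂ) :
    bargmann φ z = (((2 / π) ^ (1 / 4 : ℝ) : ℝ) : ℂ) * (Complex.exp (-(z ^ 2 / 2)) *
      ∫ x : ℝ, φ x * Complex.exp (2 * (x : ℂ) * z - (x : ℂ) ^ 2)) := by
  rw [bargmann, ← integral_const_mul (Complex.exp (-(z ^ 2 / 2)))]
  congr 2
  funext x
  rw [sub_eq_add_neg (_ - _), Complex.exp_add]
  ring

/-- Differentiation under the integral sign in the Bargmann transform. -/
theorem integrable_and_hasDerivAt_integral_mul_exp (φ : L2R) (z₀ : ℂ) :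
    Integrable (fun x : ℝ => φ x * (2 * x * Complex.exp (2 * (x : ℂ) * z₀ - (x : ℂ) ^ 2))) ∧
    HasDerivAt (fun z : ℂ => ∫ x : ℝ, φ x * Complex.exp (2 * (x : ℂ) * z - (x : ℂ) ^ 2))
      (∫ x : ℝ, φ x * (2 * x * Complex.exp (2 * (x : ℂ) * z₀ - (x : ℂ) ^ 2))) z₀ := by
  have hφ : AEStronglyMeasurable φ volume := (Lp.memLp φ).1
  -- One unit is the radius of the ball around z₀, the other absorbs |2x| ≤ exp(2|x|). The bound
  -- adds the kernels at R and -R to cover both signs of x.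
  let R : ℝ := ‖z₀‖ + 2
  refine hasDerivAt_integral_of_dominated_loc_of_deriv_le (Metric.ball_mem_nhds z₀ one_pos)
    (F' := fun z x => φ x * (2 * x * Complex.exp (2 * (x : ℂ) * z - (x : ℂ) ^ 2)))
    (.of_forall fun z => (integrable_mul_exp φ z).1) (integrable_mul_exp φ z₀)
    (hφ.mul (f := φ) (g := fun x : ℝ => 2 * (x : ℂ) * Complex.exp (2 * (x : ℂ) * z₀ - (x : ℂ) ^ 2))
      (Continuous.aestronglyMeasurable (by fun_prop)))
    (bound := fun x => ‖φ x * Complex.exp (2 * (x : ℂ) * (R : ℂ) - (x : ℂ) ^ 2)‖ +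
      ‖φ x * Complex.exp (2 * (x : ℂ) * ((-R : ℝ) : ℂ) - (x : ℂ) ^ 2)‖)
    (.of_forall fun x z hz => ?_)
    ((integrable_mul_exp φ R).norm.add (integrable_mul_exp φ ((-R : ℝ) : ℂ)).norm)
    (.of_forall fun x z hz => ?_)
  · simp only [norm_mul _ (Complex.exp _), norm_mul (φ x)]
    rw [← mul_add]
    refine mul_le_mul_of_nonneg_left ?_ (norm_nonneg _)
    have hzn : ‖z‖ ≤ ‖z₀‖ + 1 := by
      have h1 : ‖z - z₀‖ < 1 := by simpa [dist_eq_norm] using hz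
      have h2 := norm_sub_norm_le z z₀
      linarith
    have hx : ‖(2 * x : ℂ)‖ ≤ rexp (2 * |x|) := by
      have : ‖(2 * x : ℂ)‖ = 2 * |x| := by simp
      rw [this]
      linarith [Real.add_one_le_exp (2 * |x|)]
    have he : ∀ w : ℂ, ‖Complex.exp (2 * (x : ℂ) * w - (x : ℂ) ^ 2)‖ =
        rexp (2 * x * w.re - x ^ 2) := fun w => by
      rw [Complex.norm_exp]
      congr 1
      rw [← Complex.ofReal_pow, Complex.sub_re, Complex.ofReal_re, ← Complex.ofReal_ofNat,
        ← Complex.ofReal_mul, Complex.re_ofReal_mul]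
    simp only [he, Complex.ofReal_re]
    have hre : 2 * x * z.re ≤ 2 * |x| * (‖z₀‖ + 1) := by
      calc 2 * x * z.re ≤ |2 * x * z.re| := le_abs_self _
        _ = 2 * |x| * |z.re| := by simp [abs_mul]
        _ ≤ 2 * |x| * (‖z₀‖ + 1) := by
          gcongr
          exact (Complex.abs_re_le_norm z).trans hzn
    have hmain : ‖(2 * x : ℂ)‖ * rexp (2 * x * z.re - x ^ 2) ≤ rexp (2 * |x| * R - x ^ 2) := by
      calc ‖(2 * x : ℂ)‖ * rexp (2 * x * z.re - x ^ 2)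
          ≤ rexp (2 * |x|) * rexp (2 * |x| * (‖z₀‖ + 1) - x ^ 2) := by gcongr
        _ = rexp (2 * |x| * R - x ^ 2) := by
          rw [← Real.exp_add]
          congr 1
          simp only [R]
          ring
    refine hmain.trans ?_
    rcases abs_cases x with ⟨h, -⟩ | ⟨h, -⟩ <;> rw [h]
    · exact le_add_of_nonneg_right (Real.exp_nonneg _)
    · rw [show 2 * -x * R = 2 * x * -R by ring]
      exact le_add_of_nonneg_left (Real.exp_nonneg _)
  · refine HasDerivAt.const_mul _ ?_
    have h := (((hasDerivAt_id z).const_mul (2 * (x : ℂ))).sub_const ((x : ℂ) ^ 2)).cexp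
    simpa [mul_comm] using h

theorem hasDerivAt_bargmann (φ : L2R) (z : ℂ) :
    HasDerivAt (bargmann φ) (2 * ((((2 / π) ^ (1 / 4 : ℝ) : ℝ) : ℂ) *
      (Complex.exp (-(z ^ 2 / 2)) * ∫ x : ℝ, (x * φ x) *
        Complex.exp (2 * (x : ℂ) * z - (x : ℂ) ^ 2))) - z * bargmann φ z) z := by
  rw [funext (bargmann_eq φ)]
  have h1 := (integrable_and_hasDerivAt_integral_mul_exp φ z).2
  have h2 : HasDerivAt (fun z : ℂ => Complex.exp (-(z ^ 2 / 2)))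
      (Complex.exp (-(z ^ 2 / 2)) * (-z)) z := by
    have := (((hasDerivAt_pow 2 z).div_const 2).neg).cexp
    simpa using this
  have h3 : ∫ x : ℝ, φ x * (2 * x * Complex.exp (2 * (x : ℂ) * z - (x : ℂ) ^ 2)) =
      2 * ∫ x : ℝ, (x * φ x) * Complex.exp (2 * (x : ℂ) * z - (x : ℂ) ^ 2) := by
    rw [← integral_const_mul]
    congr 1 with x
    ring
  rw [h3] at h1
  refine ((h2.mul h1).const_mul _).congr_deriv ?_
  ring

theorem differentiable_bargmann (φ : L2R) : Differentiable ℂ (bargmann φ) :=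
  fun z => (hasDerivAt_bargmann φ z).differentiableAt

/-- No condition on xφ is needed, since the Gaussian decay of the kernel makes the integral
converge; the domain question is thereby reduced to recognising this integral as a transform. -/
theorem half_mul_bargmann_add_deriv (φ : L2R) (z : ℂ) :
    1 / 2 * (z * bargmann φ z + deriv (bargmann φ) z) = (((2 / π) ^ (1 / 4 : ℝ) : ℝ) : ℂ) *
      (Complex.exp (-(z ^ 2 / 2)) * ∫ x : ℝ, (x * φ x) *
        Complex.exp (2 * (x : ℂ) * z - (x : ℂ) ^ 2)) := by
  rw [(hasDerivAt_bargmann φ z).deriv]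
  ring

/-! ### The transform is isometric -/

theorem memLp_mul_gaussian (φ : L2R) (u : ℝ) :
    MemLp (fun x : ℝ => φ x * ((rexp (-(x - u) ^ 2) : ℝ) : ℂ)) 2 volume := by
  refine (Lp.memLp φ).of_le ((Lp.memLp φ).1.mul (Continuous.aestronglyMeasurable (by fun_prop)))
    (.of_forall fun x => ?_)
  rw [norm_mul, Complex.norm_real, Real.norm_of_nonneg (Real.exp_nonneg _)]
  exact mul_le_of_le_one_right (norm_nonneg _) (Real.exp_le_one_iff.2 (by nlinarith [sq_nonneg (x - u)]))

/-- With values in `ENNReal`, Tonelli applies without prior integrability, so membership in F² comes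
out together with the norm identity. -/
theorem lintegral_enorm_bargmann_sq (φ : L2R) :
    ∫⁻ z, ‖bargmann φ z‖ₑ ^ 2 ∂gaussian = ∫⁻ x, ‖φ x‖ₑ ^ 2 := by
  have hcont := (differentiable_bargmann φ).continuous
  have hφm : Measurable fun x => ‖φ x‖ₑ ^ 2 := by
    have := (Lp.stronglyMeasurable φ).measurable
    fun_prop
  let g : ℝ → ℝ → ℂ := fun u x => φ x * ((rexp (-(x - u) ^ 2) : ℝ) : ℂ)
  have hg2 : ∀ u, MemLp (g u) 2 volume := memLp_mul_gaussian φ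
  have hg1 : ∀ u, Integrable (g u) := fun u => by
    refine ((integrable_mul_exp φ u).const_mul (Complex.exp (-u ^ 2))).congr (.of_forall fun x => ?_)
    simp only [g]
    push_cast
    rw [mul_left_comm, ← Complex.exp_add]
    congr 2
    ring
  rw [lintegral_gaussian (by fun_prop),
    ← Complex.volume_preserving_equiv_real_prod.symm.lintegral_comp_emb
      Complex.measurableEquivRealProd.symm.measurableEmbedding, Measure.volume_eq_prod,
    lintegral_prod _ (by
      apply Measurable.aemeasurable
      have h : Measurable fun z : ℂ =>
          ENNReal.ofReal (π⁻¹ * rexp (-‖z‖ ^ 2)) * ‖bargmann φ z‖ₑ ^ 2 := by fun_prop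
      exact h.comp Complex.measurableEquivRealProd.symm.measurable)]
  -- The exponents -(u²+v²), -(u²-v²) from |exp(-z²/2)|², and 2u² from completing the square add up
  -- to 0.
  have hpt : ∀ u v : ℝ, ENNReal.ofReal (π⁻¹ *
      rexp (-‖Complex.measurableEquivRealProd.symm (u, v)‖ ^ 2)) *
      ‖bargmann φ (Complex.measurableEquivRealProd.symm (u, v))‖ₑ ^ 2 =
      ENNReal.ofReal (√(2 / π) / π) * ‖𝓕 (g u) (-π⁻¹ * v)‖ₑ ^ 2 := by
    intro u v
    have hz : Complex.measurableEquivRealProd.symm (u, v) = u + v * Complex.I := by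
      apply Complex.ext <;> simp
    rw [hz]
    have hF : 𝓕 (g u) (-π⁻¹ * v) = Complex.exp (-u ^ 2) *
        ∫ x : ℝ, φ x * Complex.exp (2 * (x : ℂ) * (u + v * Complex.I) - (x : ℂ) ^ 2) := by
      rw [Real.fourier_real_eq_integral_exp_smul, ← integral_const_mul]
      congr 1 with x
      simp only [g, smul_eq_mul]
      push_cast
      rw [mul_left_comm, ← Complex.exp_add, mul_left_comm (Complex.exp _), ← Complex.exp_add]
      congr 2
      have : (π : ℂ) ≠ 0 := by exact_mod_cast Real.pi_ne_zero
      field_simp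
      ring
    have hB := bargmann_eq φ (u + v * Complex.I)
    have hI : ∫ x : ℝ, φ x * Complex.exp (2 * (x : ℂ) * (u + v * Complex.I) - (x : ℂ) ^ 2) =
        Complex.exp (u ^ 2) * 𝓕 (g u) (-π⁻¹ * v) := by
      rw [hF, ← mul_assoc, ← Complex.exp_add]
      simp
    rw [hI] at hB
    rw [hB, ← ofReal_norm, ← ofReal_norm, ← ENNReal.ofReal_pow (norm_nonneg _),
      ← ENNReal.ofReal_pow (norm_nonneg _), ← ENNReal.ofReal_mul (by positivity),
      ← ENNReal.ofReal_mul (by positivity)]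
    congr 1
    simp only [norm_mul, mul_pow, Complex.norm_real, Complex.norm_exp, ← Real.exp_nat_mul]
    have hc : ‖((2 / π) ^ (1 / 4 : ℝ) : ℝ)‖ ^ 2 = √(2 / π) := by
      rw [Real.norm_of_nonneg (by positivity), ← Real.rpow_natCast, ← Real.rpow_mul (by positivity),
        Real.sqrt_eq_rpow]
      norm_num
    have hn : ‖(u + v * Complex.I : ℂ)‖ ^ 2 = u ^ 2 + v ^ 2 := by
      rw [Complex.sq_norm, Complex.normSq_add_mul_I]
    have h1 : (-((u + v * Complex.I : ℂ) ^ 2 / 2)).re = -((u ^ 2 - v ^ 2) / 2) := by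
      simp [sq]
    have h2 : ((u : ℂ) ^ 2).re = u ^ 2 := by rw [← Complex.ofReal_pow, Complex.ofReal_re]
    rw [hc, hn, h1, h2]
    have hexp : rexp (-(u ^ 2 + v ^ 2)) *
        (rexp ((2 : ℕ) * -((u ^ 2 - v ^ 2) / 2)) * rexp ((2 : ℕ) * u ^ 2)) = 1 := by
      rw [← Real.exp_add, ← Real.exp_add, Real.exp_eq_one_iff]
      push_cast
      ring
    linear_combination (π⁻¹ * √(2 / π) * ‖𝓕 (g u) (-π⁻¹ * v)‖ ^ 2) * hexp
  -- The substitution ξ = -v/π contributes the factor π that cancels the one in the denominator.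
  have hinner : ∀ u : ℝ, ∫⁻ v, ENNReal.ofReal (√(2 / π) / π) * ‖𝓕 (g u) (-π⁻¹ * v)‖ₑ ^ 2 =
      ENNReal.ofReal √(2 / π) *
        ∫⁻ x, ‖φ x‖ₑ ^ 2 * ENNReal.ofReal (rexp (-2 * (u - x) ^ 2)) := by
    intro u
    have hm : Measurable fun ξ => ‖𝓕 (g u) ξ‖ₑ ^ 2 := by
      have : Continuous (𝓕 (g u)) :=
        VectorFourier.fourierIntegral_continuous Real.continuous_fourierChar (by fun_prop) (hg1 u)
      fun_prop
    have hπ : (-π⁻¹) ≠ 0 := neg_ne_zero.2 (inv_ne_zero Real.pi_ne_zero)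
    rw [lintegral_const_mul (f := fun v => ‖𝓕 (g u) (-π⁻¹ * v)‖ₑ ^ 2) _
        (hm.comp (measurable_const_mul _)),
      ← lintegral_map (f := fun ξ => ‖𝓕 (g u) ξ‖ₑ ^ 2) hm (measurable_const_mul _), Real.map_volume_mul_left hπ,
      lintegral_smul_measure, lintegral_enorm_fourier_sq (hg1 u) (hg2 u), smul_eq_mul, ← mul_assoc,
      ← ENNReal.ofReal_mul (by positivity)]
    congr 2
    · rw [inv_neg, inv_inv, abs_neg, abs_of_pos Real.pi_pos, div_mul_cancel₀ _ Real.pi_ne_zero]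
    · ext x
      simp only [g]
      rw [enorm_mul, mul_pow]
      congr 1
      rw [← ofReal_norm, Complex.norm_real, Real.norm_of_nonneg (Real.exp_nonneg _),
        ← ENNReal.ofReal_pow (Real.exp_nonneg _), ← Real.exp_nat_mul]
      congr 2
      push_cast
      ring
  have hgauss : ∀ x : ℝ, ∫⁻ u, ENNReal.ofReal (rexp (-2 * (u - x) ^ 2)) =
      ENNReal.ofReal √(π / 2) := by
    intro x
    rw [lintegral_sub_right_eq_self (fun u => ENNReal.ofReal (rexp (-2 * u ^ 2))) x,
      ← ofReal_integral_eq_lintegral_ofReal (integrable_exp_neg_mul_sq two_pos)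
        (.of_forall fun _ => Real.exp_nonneg _), integral_gaussian]
  simp_rw [hpt, hinner]
  rw [lintegral_const_mul _ (by fun_prop), lintegral_lintegral_swap (by fun_prop)]
  have : ∀ x : ℝ, ∫⁻ u, ‖φ x‖ₑ ^ 2 * ENNReal.ofReal (rexp (-2 * (u - x) ^ 2)) =
      ‖φ x‖ₑ ^ 2 * ENNReal.ofReal √(π / 2) := fun x => by
    rw [lintegral_const_mul _ (by fun_prop), hgauss]
  simp_rw [this]
  rw [lintegral_mul_const _ hφm, mul_left_comm, ← ENNReal.ofReal_mul (by positivity),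
    ← Real.sqrt_mul (by positivity)]
  have : 2 / π * (π / 2) = 1 := by field_simp
  rw [this]
  simp

theorem eLpNorm_two_sq {α : Type*} {m : MeasurableSpace α} (μ : Measure α) (f : α → ℂ) :
    eLpNorm f 2 μ ^ 2 = ∫⁻ x, ‖f x‖ₑ ^ 2 ∂μ := by
  simpa using eLpNorm_nnreal_pow_eq_lintegral (p := 2) (μ := μ) (f := f) two_ne_zero

theorem eLpNorm_bargmann (φ : L2R) : eLpNorm (bargmann φ) 2 gaussian = eLpNorm φ 2 volume := by
  refine (ENNReal.pow_right_strictMono two_ne_zero).injective ?_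
  simp only [eLpNorm_two_sq, lintegral_enorm_bargmann_sq]

theorem bargmann_mem_fockSubmodule (φ : L2R) : bargmann φ ∈ fockSubmodule := by
  have hd := differentiable_bargmann φ
  refine ⟨hd, hd.continuous.aestronglyMeasurable, ?_⟩
  rw [eLpNorm_bargmann]
  exact (Lp.memLp φ).2

theorem FockSpace.toReal_eLpNorm (f : FockSpace) : (eLpNorm f 2 gaussian).toReal = ‖f‖ := by
  rw [← sq_eq_sq₀ ENNReal.toReal_nonneg (norm_nonneg _), ← ENNReal.toReal_pow, eLpNorm_two_sq,
    FockSpace.norm_sq_eq, integral_eq_lintegral_of_nonneg_ae (.of_forall fun _ => by positivity)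
      (by have := f.differentiable.continuous; fun_prop)]
  simp [ENNReal.ofReal_pow]

/-- The Bargmann transform as a linear isometry. -/
def bargmannLinearIsometry : L2R →ₗᵢ[ℂ] FockSpace where
  toFun φ := FockSpace.mk (bargmann φ) (bargmann_mem_fockSubmodule φ)
  map_add' φ ψ := FockSpace.ext fun z => by
    simp only [FockSpace.mk_apply, FockSpace.add_apply, bargmann]
    rw [← mul_add, ← integral_add (integrable_bargmann φ z) (integrable_bargmann ψ z)]
    congr 1
    refine integral_congr_ae ?_
    filter_upwards [Lp.coeFn_add φ ψ] with x hx
    rw [hx, Pi.add_apply, add_mul]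
  map_smul' a φ := FockSpace.ext fun z => by
    simp only [FockSpace.mk_apply, FockSpace.smul_apply, bargmann, RingHom.id_apply]
    rw [mul_left_comm, ← integral_const_mul a]
    congr 1
    refine integral_congr_ae ?_
    filter_upwards [Lp.coeFn_smul a φ] with x hx
    rw [hx, Pi.smul_apply, smul_eq_mul, mul_assoc]
  norm_map' φ := by
    rw [← FockSpace.toReal_eLpNorm, Lp.norm_def, ← eLpNorm_bargmann]
    rfl

theorem bargmannLinearIsometry_apply (φ : L2R) (z : ℂ) :
    bargmannLinearIsometry φ z = bargmann φ z := rfl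

/-! ### Reproducing kernel and surjectivity -/

/-- The Bargmann transform maps translated Gaussians to multiples of exponential functions. -/
theorem exists_bargmann_eq_exp (w : ℂ) :
    ∃ (φ : L2R) (C : ℂ), C ≠ 0 ∧ ∀ z, bargmann φ z = C * Complex.exp (z * w) := by
  have hπ : (π : ℂ) ≠ 0 := by exact_mod_cast Real.pi_ne_zero
  -- The product with the kernel has exponent -2x² + 2(z+w)x - z²/2; integrating leaves (z+w)²/2 -
  -- z²/2 = zw + w²/2.
  refine ⟨(memLp_exp_quadratic w).toLp, (((2 / π) ^ (1 / 4 : ℝ) : ℝ) : ℂ) *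
    ((π / -(-2 : ℂ)) ^ (1 / 2 : ℂ) * Complex.exp (w ^ 2 / 2)), ?_, fun z => ?_⟩
  · have h1 : ((2 / π) ^ (1 / 4 : ℝ) : ℝ) ≠ 0 := by positivity
    have h2 : (π / -(-2 : ℂ)) ^ (1 / 2 : ℂ) ≠ 0 := by simp [Complex.cpow_eq_zero_iff, hπ]
    exact mul_ne_zero (by exact_mod_cast h1) (mul_ne_zero h2 (Complex.exp_ne_zero _))
  · have h : ∫ x : ℝ, (memLp_exp_quadratic w).toLp _ x *
        Complex.exp (2 * (x : ℂ) * z - (x : ℂ) ^ 2 - z ^ 2 / 2) =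
        ∫ x : ℝ, Complex.exp (-2 * (x : ℂ) ^ 2 + (2 * (z + w)) * x + -(z ^ 2 / 2)) := by
      refine integral_congr_ae ?_
      filter_upwards [(memLp_exp_quadratic w).coeFn_toLp] with x hx
      rw [hx, ← Complex.exp_add]
      congr 1
      ring
    rw [bargmann, h, integral_cexp_quadratic (by norm_num), mul_assoc, mul_assoc, ← Complex.exp_add]
    congr 3
    ring

/-- The reproducing property of the exponential kernel in the Fock space. -/
theorem integral_conj_exp_mul (f : FockSpace) (w : ℂ) :
    ∫ z, conj (Complex.exp (z * w)) * f z ∂gaussian = f (conj w) := by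
  -- The exponential is in F², being a multiple of a Bargmann transform.
  have hint : Integrable (fun z => conj (Complex.exp (z * w)) * f z) gaussian := by
    obtain ⟨φ, C, hC, hφ⟩ := exists_bargmann_eq_exp w
    refine ((FockSpace.integrable_conj_mul (bargmannLinearIsometry φ) f).const_mul
      (conj C)⁻¹).congr (.of_forall fun z => ?_)
    have hC' : conj C ≠ 0 := by simpa using hC
    simp only [bargmannLinearIsometry_apply, hφ, map_mul]
    field_simp
  rw [integrable_gaussian_iff] at hint
  -- Translation by conj w leaves an entire function times the centred Gaussian, so the mean value
  -- property evaluates it at 0.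
  have hpt : ∀ z : ℂ, ((π⁻¹ * rexp (-‖z + conj w‖ ^ 2) : ℝ) : ℂ) *
      (conj (Complex.exp ((z + conj w) * w)) * f (z + conj w)) =
      (π : ℂ)⁻¹ * ((f (z + conj w) * Complex.exp (-(z * w))) * ((rexp (-‖z‖ ^ 2) : ℝ) : ℂ)) := by
    intro z
    rw [← Complex.exp_conj]
    push_cast
    rw [← Complex.mul_conj', ← Complex.mul_conj']
    have : Complex.exp (-((z + conj w) * conj (z + conj w))) *
        Complex.exp (conj ((z + conj w) * w)) =
        Complex.exp (-(z * w)) * Complex.exp (-(z * conj z)) := by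
      rw [← Complex.exp_add, ← Complex.exp_add]
      congr 1
      simp only [map_add, map_mul, Complex.conj_conj]
      ring
    linear_combination (π : ℂ)⁻¹ * f (z + conj w) * this
  have hπ : (π : ℂ) ≠ 0 := by exact_mod_cast Real.pi_ne_zero
  have hint' := hint.comp_add_right (conj w)
  simp only [hpt] at hint'
  have hint'' := hint'.const_mul (π : ℂ)
  simp only [mul_inv_cancel_left₀ hπ] at hint''
  have hd : Differentiable ℂ fun z => f (z + conj w) * Complex.exp (-(z * w)) := by
    have := f.differentiable
    fun_prop
  rw [integral_gaussian_measure, ← integral_add_right_eq_self _ (conj w)]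
  simp_rw [hpt]
  rw [integral_const_mul, integral_mul_exp_neg_norm_sq hd hint'']
  simp [hπ]

/-- The range inherits completeness from L²(ℝ), so completeness of F² is not needed beforehand. -/
theorem surjective_bargmannLinearIsometry : Function.Surjective bargmannLinearIsometry := by
  let K := LinearMap.range bargmannLinearIsometry.toLinearMap
  have hK : IsComplete (K : Set FockSpace) := by
    have := bargmannLinearIsometry.isometry.isUniformInducing.isComplete_range
    simpa [K, LinearMap.coe_range] using this
  have : CompleteSpace K := hK.completeSpace_coe
  have hbot : Kᗮ = ⊥ := by
    refine (Submodule.eq_bot_iff _).2 fun f hf => FockSpace.ext fun z => ?_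
    obtain ⟨φ, C, hC, hφ⟩ := exists_bargmann_eq_exp (conj z)
    have h : inner ℂ (bargmannLinearIsometry φ) f = 0 := hf _ ⟨φ, rfl⟩
    rw [FockSpace.inner_def] at h
    simp only [bargmannLinearIsometry_apply, hφ, map_mul, mul_assoc] at h
    rw [integral_const_mul] at h
    rw [integral_conj_exp_mul, Complex.conj_conj] at h
    simpa [hC] using h
  exact LinearMap.range_eq_top.1 (K.orthogonal_eq_bot_iff.1 hbot)

/-- The Bargmann transform as a unitary operator. -/
def bargmannEquiv : L2R ≃ₗᵢ[ℂ] FockSpace :=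
  LinearIsometryEquiv.ofSurjective bargmannLinearIsometry surjective_bargmannLinearIsometry

theorem bargmannEquiv_apply (φ : L2R) (z : ℂ) : bargmannEquiv φ z = bargmann φ z := rfl

theorem coe_bargmannEquiv (φ : L2R) : (bargmannEquiv φ : ℂ → ℂ) = bargmann φ := rfl

/-! ### Conjugating multiplication by x -/

/-- The transform of `x φ(x)` is `(z f(z) + f'(z)) / 2`, where `f` is the transform of `φ`. -/
theorem half_mul_add_deriv_eq_bargmann {φ ψ : L2R} (h : ψ =ᵐ[volume] fun x : ℝ => x * φ x) (z : ℂ) :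
    1 / 2 * (z * bargmann φ z + deriv (bargmann φ) z) = bargmann ψ z := by
  rw [half_mul_bargmann_add_deriv, bargmann_eq]
  congr 2
  refine integral_congr_ae ?_
  filter_upwards [h] with x hx
  rw [hx]

/-- Injectivity on L² does not suffice, as xφ is not known to be in L². The factor exp(-x²) brings
xφ - ψ into L¹ ∩ L², where Fourier uniqueness applies. -/
theorem ae_eq_mul_of_bargmann_eq {φ ψ : L2R}
    (h : ∀ z, 1 / 2 * (z * bargmann φ z + deriv (bargmann φ) z) = bargmann ψ z) :
    ψ =ᵐ[volume] fun x : ℝ => x * φ x := by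
  have hc : (((2 / π) ^ (1 / 4 : ℝ) : ℝ) : ℂ) ≠ 0 := by
    have h1 : ((2 / π) ^ (1 / 4 : ℝ) : ℝ) ≠ 0 := by positivity
    exact_mod_cast h1
  have hint : ∀ z : ℂ, Integrable fun x : ℝ => (x * φ x) *
      Complex.exp (2 * (x : ℂ) * z - (x : ℂ) ^ 2) := fun z => by
    refine ((integrable_and_hasDerivAt_integral_mul_exp φ z).1.const_mul (1 / 2)).congr
      (.of_forall fun x => ?_)
    ring
  let g : ℝ → ℂ := fun x => (x * φ x - ψ x) * Complex.exp (-(x : ℂ) ^ 2)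
  have hg : ∀ z : ℂ, ∫ x, g x * Complex.exp (2 * (x : ℂ) * z) = 0 := by
    intro z
    have hz := h z
    rw [half_mul_bargmann_add_deriv, bargmann_eq] at hz
    have hz' := mul_left_cancel₀ (Complex.exp_ne_zero _) (mul_left_cancel₀ hc hz)
    rw [← sub_eq_zero, ← integral_sub (hint z) (integrable_mul_exp ψ z)] at hz'
    rw [← hz']
    congr 1 with x
    simp only [g]
    rw [mul_assoc, ← Complex.exp_add, ← sub_mul]
    congr 2
    ring
  have hg1 : Integrable g := by
    refine ((hint 0).sub (integrable_mul_exp ψ 0)).congr (.of_forall fun x => ?_)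
    simp [g, sub_mul]
  have hg2 : MemLp g 2 volume := by
    have h1 : MemLp (fun x : ℝ => (x * φ x) * Complex.exp (-(x : ℂ) ^ 2)) 2 volume := by
      refine (Lp.memLp φ).of_le (((Complex.continuous_ofReal.aestronglyMeasurable).mul
        (Lp.memLp φ).1).mul (Continuous.aestronglyMeasurable (by fun_prop))) (.of_forall fun x => ?_)
      have hexp : ‖Complex.exp (-(x : ℂ) ^ 2)‖ = rexp (-x ^ 2) := by
        rw [← Complex.ofReal_pow, ← Complex.ofReal_neg, Complex.norm_exp_ofReal]
      have hx : |x| * rexp (-x ^ 2) ≤ 1 := by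
        rw [Real.exp_neg, ← div_eq_mul_inv, div_le_one (Real.exp_pos _)]
        nlinarith [Real.add_one_le_exp (x ^ 2), sq_nonneg (|x| - 1), sq_abs x]
      rw [norm_mul, norm_mul, Complex.norm_real, Real.norm_eq_abs, hexp]
      calc |x| * ‖φ x‖ * rexp (-x ^ 2) = ‖φ x‖ * (|x| * rexp (-x ^ 2)) := by ring
        _ ≤ ‖φ x‖ := mul_le_of_le_one_right (norm_nonneg _) hx
    have h2 : MemLp (fun x : ℝ => ψ x * Complex.exp (-(x : ℂ) ^ 2)) 2 volume := by
      simpa using memLp_mul_gaussian ψ 0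
    refine (memLp_congr_ae (.of_forall fun x => ?_)).1 (h1.sub h2)
    simp [g, sub_mul]
  have hg0 : g =ᵐ[volume] 0 := by
    refine ae_eq_zero_of_fourier_eq_zero hg1 hg2 fun ξ => ?_
    -- At z = -πiξ the factor exp(2xz) is the Fourier character.
    rw [Real.fourier_real_eq_integral_exp_smul, ← hg (-(π * ξ * Complex.I))]
    congr 1 with x
    rw [smul_eq_mul, mul_comm]
    congr 2
    push_cast
    ring
  filter_upwards [hg0] with x hx
  have := (mul_eq_zero.1 hx).resolve_right (Complex.exp_ne_zero _)
  exact (sub_eq_zero.1 this).symm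

theorem mem_mulX_domain_iff (φ : L2R) :
    φ ∈ mulX.domain ↔ bargmannEquiv φ ∈ fockX.domain := by
  constructor
  · intro hφ
    have hφ' : MemLp (fun x : ℝ => (x : ℂ) * φ x) 2 volume := hφ
    show (fun z : ℂ => 1 / 2 * (z * bargmann φ z + deriv (bargmann φ) z)) ∈ fockSubmodule
    rw [funext (half_mul_add_deriv_eq_bargmann hφ'.coeFn_toLp)]
    exact bargmann_mem_fockSubmodule _
  · intro hφ
    -- Surjectivity supplies the L² function that must be xφ.
    obtain ⟨ψ, hψ⟩ := bargmannEquiv.surjective (FockSpace.mk _ hφ)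
    have h := ae_eq_mul_of_bargmann_eq (φ := φ) (ψ := ψ) fun z =>
      (DFunLike.congr_fun hψ z).symm
    exact (memLp_congr_ae h).1 (Lp.memLp ψ)

theorem conjOp_bargmannEquiv_mulX : conjOp bargmannEquiv mulX = fockX := by
  refine LinearPMap.ext (Submodule.ext fun f => ?_) fun f hf hf' => FockSpace.ext fun z => ?_
  · have h := mem_mulX_domain_iff (bargmannEquiv.symm f)
    rw [LinearIsometryEquiv.apply_symm_apply] at h
    exact h
  · have hφ : MemLp (fun x : ℝ => (x : ℂ) * bargmannEquiv.symm f x) 2 volume := hf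
    have h := half_mul_add_deriv_eq_bargmann hφ.coeFn_toLp z
    rw [← coe_bargmannEquiv, LinearIsometryEquiv.apply_symm_apply] at h
    exact h.symm

end Bargmann

end

theorem theorem19 :
    ∃ B : Bargmann.L2R ≃ₗᵢ[ℂ] Bargmann.FockSpace,
      (∀ (φ : Bargmann.L2R) (z : ℂ), B φ z = Bargmann.bargmann φ z) ∧
        Bargmann.conjOp B Bargmann.mulX = Bargmann.fockX :=
  ⟨Bargmann.bargmannEquiv, Bargmann.bargmannEquiv_apply, Bargmann.conjOp_bargmannEquiv_mulX⟩
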